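/- Setting. Let $X\subset\mathbb R^n$ be nonempty, closed and convex, $f:\mathbb R^n\to\mathbb R$ continuous and quasiconvex, $\nu\in\mathbb R$, and $X_\nu=\{x\in X: f(x)\le\nu\}$. Let $\xi$ be a random vector whose law $\mathbb P$ is supported on $\Xi\subset\mathbb R^d$, let $m\ge 1$, and let $g=(g_1,\dots,g_m):\mathbb R^n\times\mathbb R^d\to\mathbb R^m$ be continuously differentiable. Put $p(x)=\mathbb P(g(x,\xi)\not\le 0)$. Let $\phi(y;\tau)$ be a real-valued function of $y\in\mathbb R$ and $\tau\ge 0$, let $\tau_{k,j}$ ($k\ge1$, $1\le j\le m$) be smoothing parameters, $\phi_{k,j}=\phi(\cdot\,;\tau_{k,j})$ and $\hat p_k(x)=\mathbb E[\max_j\phi_{k,j}(g_j(x,\xi))]$. Assume: 1. For every $j$: (A) for every $\xi\in\Xi$, $g_j(\cdot,\xi)$ is Lipschitz on $X_\nu$ with a nonnegative measurable constant $L_{g,j}(\xi)$, $\mathbb E[L_{g,j}^2(\xi)]<\infty$; (B) for every $\xi\in\Xi$, $\nabla_x g_j(\cdot,\xi)$ is Lipschitz on $X_\nu$ with a nonnegative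 measurable constant $L'_{g,j}(\xi)$, $\mathbb E[L'_{g,j}(\xi)]<\infty$; (C) there is $\sigma_{g,j}>0$ with $\mathbb E\|\nabla_x g_j(x,\xi)\|^2\le\sigma_{g,j}^2$ for all $x\in X_\nu$. 2. Each $\phi_{k,j}$ is continuously differentiable and nondecreasing; there is a constant $M_\phi>0$ with $|\phi_{k,j}|\le M_\phi$ for all $k,j$; and, for every $y\ne0$ and every $j$, $\phi_{k,j}(y)\to 1$ if $y>0$ and $\phi_{k,j}(y)\to0$ if $y<0$, as $k\to\infty$. 3. Each derivative $\phi_{k,j}'$ is bounded and Lipschitz on $\mathbb R$ (with constants that may depend on $k$ and $j$). 4. (A) There is $\tau_c\in(0,1)$ with $\tau_{k+1,j}=\tau_c\tau_{k,j}$ and $\tau_{1,j}>0$ for all $k,j$, and $\phi(\lambda y;\lambda z)=\phi(y;z)$ for all $\lambda,z>0$, $y\in\mathbb R$. (B) Let $F(x,\eta)=\mathbb P(\max_j g_j(x,\xi)/\tau_{1,j}\le\eta)$. There are $\theta>0$ and an open set $\bar X\supset X_\nu$ such that $F$ is continuously differentiable on $\bar X\times(-\theta,\theta)$, and, for each $\eta\in\mathbb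 R$, $F(\cdot,\eta)$ is Lipschitz on $\bar X$ with a constant $L_F(\eta)\ge0$, where $L_F$ is measurable and $\int_{\mathbb R} L_F(\eta)\,d\eta<\infty$. (C) There are positive numbers $\varepsilon_k\downarrow0$ with $$\int_{|\eta|\ge\varepsilon_k}L_F(\eta)\,\tfrac{\partial\phi}{\partial y}(\eta;\tau_c^{k-1})\,d\eta\to0,\qquad \phi(\varepsilon_k;\tau_c^{k-1})-\phi(-\varepsilon_k;\tau_c^{k-1})\to1\qquad(k\to\infty).$$ Claim. Each $\hat p_k$ is Lipschitz near every point of $X_\nu$, $p$ is differentiable at every point of $X_\nu$, and for every $\bar x$ $$\limsup_{x\to\bar x,\;k\to\infty}\bigl(\partial\hat p_k(x)+N_{X_\nu}(x)\bigr)\subset\{\nabla p(\bar x)\}+N_{X_\nu}(\bar x).$$ Here $\partial h(x)=\{\zeta:\langle\zeta,v\rangle\le h^\circ(x;v)\ \forall v\}$ with $h^\circ(x;v)=\limsup_{y\to x,\,t\downarrow0}(h(y+tv)-h(y))/t$ is the Clarke generalized gradient; $N_{X_\nu}(x)$ is the normal cone $\{v:\langle v,y-x\rangle\le0\ \forall y\in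 X_\nu\}$ for $x\in X_\nu$ and is empty for $x\notin X_\nu$; and the outer limit is the set of all limits of sequences $v_i\in\partial\hat p_{k_i}(x_i)+N_{X_\nu}(x_i)$ with $x_i\to\bar x$ and $k_i\to\infty$. For $\bar x\notin X_\nu$ both sides are empty. -/

import Mathlib

open Set Filter Topology MeasureTheory
open scoped NNReal Pointwise

noncomputable section

namespace ChanceConstraint

section VariationalAnalysis

variable {E : Type*} [NormedAddCommGroup E] [InnerProductSpace ℝ E]

/-- `f` is Lipschitz continuous on some neighbourhood of `x`. -/
def LipschitzNear (f : E → ℝ) (x : E) : Prop :=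
  ∃ K : ℝ≥0, ∃ U ∈ 𝓝 x, LipschitzOnWith K f U

/-- Clarke's generalized directional derivative
`f°(x; v) = limsup_{y → x, t ↓ 0} (f (y + t v) - f y) / t`, as an extended real. -/
def clarkeDirDeriv (f : E → ℝ) (x v : E) : EReal :=
  limsup (fun q : E × ℝ => (((f (q.1 + q.2 • v) - f q.1) / q.2 : ℝ) : EReal))
    (𝓝 x ×ˢ 𝓝[>] (0 : ℝ))

/-- The Clarke generalized gradient `∂f(x) = {ζ | ⟪ζ, v⟫ ≤ f°(x; v) for all v}`. -/
def clarkeGradient (f : E → ℝ) (x : E) : Set E :=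
  {ζ | ∀ v : E, ((inner ℝ ζ v : ℝ) : EReal) ≤ clarkeDirDeriv f x v}

/-- The normal cone of a convex set `C` at `x`, empty when `x ∉ C`. -/
def normalCone (C : Set E) (x : E) : Set E :=
  {v | x ∈ C ∧ ∀ y ∈ C, inner ℝ v (y - x) ≤ (0 : ℝ)}

/-- The outer limit of `S k x` as `x → a` and `k → ∞`: all limits of sequences `v i ∈ S (κ i) (x i)`
with `x i → a` and `κ i → ∞`. -/
def outerLimit (S : ℕ → E → Set E) (a : E) : Set E :=
  {v | ∃ (κ : ℕ → ℕ) (x w : ℕ → E), Tendsto κ atTop atTop ∧ Tendsto x atTop (𝓝 a) ∧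
    (∀ i, w i ∈ S (κ i) (x i)) ∧ Tendsto w atTop (𝓝 v)}

end VariationalAnalysis

variable {n d m : ℕ}

/-- The feasible set `X_ν = {x ∈ X | f x ≤ ν}`. -/
def levelSet (X : Set (EuclideanSpace ℝ (Fin n))) (f : EuclideanSpace ℝ (Fin n) → ℝ) (ν : ℝ) :
    Set (EuclideanSpace ℝ (Fin n)) :=
  {x | x ∈ X ∧ f x ≤ ν}

/-- The probability of constraint violation `p(x) = ℙ(g(x, ξ) ≰ 0)`. -/
def violationProb (P : Measure (EuclideanSpace ℝ (Fin d)))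
    (g : Fin m → EuclideanSpace ℝ (Fin n) → EuclideanSpace ℝ (Fin d) → ℝ)
    (x : EuclideanSpace ℝ (Fin n)) : ℝ :=
  P.real {ξ | ¬ ∀ j, g j x ξ ≤ 0}

/-- The smoothed objective `E[max_j ψ_j(g_j(x, ξ))]`. -/
def smoothedProb (P : Measure (EuclideanSpace ℝ (Fin d)))
    (g : Fin m → EuclideanSpace ℝ (Fin n) → EuclideanSpace ℝ (Fin d) → ℝ)
    (ψ : Fin m → ℝ → ℝ) (x : EuclideanSpace ℝ (Fin n)) : ℝ :=
  ∫ ξ, (⨆ j, ψ j (g j x ξ)) ∂P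

/-- The distribution function `F(x, η) = ℙ(max_j g_j(x, ξ) / s_j ≤ η)`. -/
def scaledCdf (P : Measure (EuclideanSpace ℝ (Fin d)))
    (g : Fin m → EuclideanSpace ℝ (Fin n) → EuclideanSpace ℝ (Fin d) → ℝ)
    (s : Fin m → ℝ) (x : EuclideanSpace ℝ (Fin n)) (η : ℝ) : ℝ :=
  P.real {ξ | (⨆ j, g j x ξ / s j) ≤ η}

/-- Regularity of the constraint functions on the feasible set `C`. -/
structure ConstraintRegularity (P : Measure (EuclideanSpace ℝ (Fin d)))
    (Ξ : Set (EuclideanSpace ℝ (Fin d))) (C : Set (EuclideanSpace ℝ (Fin n)))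
    (g : Fin m → EuclideanSpace ℝ (Fin n) → EuclideanSpace ℝ (Fin d) → ℝ) : Prop where
  lipschitz : ∀ j, ∃ L : EuclideanSpace ℝ (Fin d) → ℝ, Measurable L ∧ (∀ ξ ∈ Ξ, 0 ≤ L ξ) ∧
    Integrable (fun ξ => L ξ ^ 2) P ∧
    ∀ ξ ∈ Ξ, ∀ x ∈ C, ∀ y ∈ C, |g j x ξ - g j y ξ| ≤ L ξ * ‖x - y‖
  gradient_lipschitz : ∀ j, ∃ L : EuclideanSpace ℝ (Fin d) → ℝ, Measurable L ∧
    (∀ ξ ∈ Ξ, 0 ≤ L ξ) ∧ Integrable L P ∧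
    ∀ ξ ∈ Ξ, ∀ x ∈ C, ∀ y ∈ C,
      ‖gradient (fun z => g j z ξ) x - gradient (fun z => g j z ξ) y‖ ≤ L ξ * ‖x - y‖
  gradient_sq : ∀ j, ∃ σ : ℝ, 0 < σ ∧ ∀ x ∈ C,
    Integrable (fun ξ => ‖gradient (fun z => g j z ξ) x‖ ^ 2) P ∧
    ∫ ξ, ‖gradient (fun z => g j z ξ) x‖ ^ 2 ∂P ≤ σ ^ 2

/-- Basic conditions on the smoothing functions `ψ k j`. -/
structure SmoothingBasic (ψ : ℕ → Fin m → ℝ → ℝ) : Prop where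
  contDiff : ∀ k j, ContDiff ℝ 1 (ψ k j)
  monotone : ∀ k j, Monotone (ψ k j)
  equibounded : ∃ M : ℝ, 0 < M ∧ ∀ k j y, |ψ k j y| ≤ M
  tendsto_step : ∀ j, ∀ y : ℝ, y ≠ 0 →
    Tendsto (fun k => ψ k j y) atTop (𝓝 (if 0 < y then 1 else 0))

/-- Boundedness and Lipschitz continuity of the derivatives of the smoothing functions, with
constants that may depend on `k` and `j`. -/
structure SmoothingAdvanced (ψ : ℕ → Fin m → ℝ → ℝ) : Prop where
  deriv_bounded : ∀ k j, ∃ M : ℝ, ∀ y, |deriv (ψ k j) y| ≤ M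
  deriv_lipschitz : ∀ k j, ∃ L : ℝ≥0, LipschitzWith L (deriv (ψ k j))

/-- The smoothing parameters are positive geometric sequences with ratio `τc ∈ (0, 1)`, and `φ` is
homogeneous of degree zero. -/
structure SmoothingScaling (φ : ℝ → ℝ → ℝ) (τ : ℕ → Fin m → ℝ) (τc : ℝ) : Prop where
  ratio_mem : τc ∈ Ioo (0 : ℝ) 1
  init_pos : ∀ j, 0 < τ 0 j
  step : ∀ k j, τ (k + 1) j = τc * τ k j
  homogeneous : ∀ l : ℝ, 0 < l → ∀ y z : ℝ, 0 < z → φ (l * y) (l * z) = φ y z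

/-- Conditions on a distribution function `F` and the kernels `φ(·; τc ^ k)`: `F` is continuously
differentiable on `X' × (-θ, θ)` for some open `X' ⊇ C` and `θ > 0`; each `F(·, η)` is Lipschitz on
`X'` with a constant `LF η`, where `LF` is integrable; and the kernels concentrate at zero fast
enough compared with `LF`. -/
def CdfCondition (C : Set (EuclideanSpace ℝ (Fin n))) (F : EuclideanSpace ℝ (Fin n) → ℝ → ℝ)
    (φ : ℝ → ℝ → ℝ) (τc : ℝ) : Prop :=
  ∃ (X' : Set (EuclideanSpace ℝ (Fin n))) (θ : ℝ) (LF : ℝ → ℝ) (ε : ℕ → ℝ),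
    IsOpen X' ∧ C ⊆ X' ∧ 0 < θ ∧
    ContDiffOn ℝ 1 (fun q : EuclideanSpace ℝ (Fin n) × ℝ => F q.1 q.2) (X' ×ˢ Ioo (-θ) θ) ∧
    (∀ η, 0 ≤ LF η) ∧ Measurable LF ∧ Integrable LF volume ∧
    (∀ η, ∀ x ∈ X', ∀ y ∈ X', |F x η - F y η| ≤ LF η * ‖x - y‖) ∧
    (∀ k, 0 < ε k) ∧ Antitone ε ∧ Tendsto ε atTop (𝓝 0) ∧
    Tendsto (fun k => ∫ η in {η : ℝ | ε k ≤ |η|}, LF η * deriv (fun y => φ y (τc ^ k)) η)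
      atTop (𝓝 0) ∧
    Tendsto (fun k => φ (ε k) (τc ^ k) - φ (-ε k) (τc ^ k)) atTop (𝓝 1)

end ChanceConstraint

end

/-!
Put `h x ξ = max_j g_j(x, ξ) / τ_{0,j}`, with distribution function `F x`, and `ψ_k = φ(·; τc ^ k)`.
Homogeneity of `φ` and monotonicity of `ψ_k` turn the smoothed objective into
`p̂_k(x) = E[ψ_k(h x ξ)]` (`smoothedProb_eq_integral`). Writing `ψ_k(h)` as the limit of `ψ_k` at
infinity minus `∫ ψ_k'(η) 𝟙[h ≤ η] dη` and exchanging the integrals gives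
`p̂_k(y) - p̂_k(x) = -∫ ψ_k'(η) (F y η - F x η) dη` (`integral_comp_sub_integral_comp`).
Since `ψ_k'` is bounded and `F(·, η)` is Lipschitz with an integrable constant, `p̂_k` is Lipschitz
near the feasible set. Moreover `p = 1 - F(·, 0)` is differentiable there.

For the inclusion, `F` is strictly differentiable at `(x₀, 0)`, being continuously differentiable
nearby. On `|η| < ε_k` the increment `F y η - F x η` is therefore `-⟪∇p(x₀), y - x⟫` up to a small
multiple of `‖y - x‖`, and `ψ_k'` has mass tending to one there; the part `|η| ≥ ε_k` contributes at
most `o(1) ‖y - x‖`. So for every `ρ > 0` the function `p̂_k - ⟪∇p(x₀), ·⟫` is `ρ`-Lipschitz on one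
neighbourhood of `x₀` for all large `k` (`eventually_abs_sub_sub_inner_le`), and there all Clarke
gradients of `p̂_k` lie within `ρ` of `∇p(x₀)` (`norm_sub_le_of_mem_clarkeGradient`). Strict
differentiability of `F` makes differentiation of `p̂_k` under the integral unnecessary. Hence the
Clarke part of a convergent sequence tends to `∇p(x₀)`, the remainder converges too, and its limit
is normal at `x₀` because the graph of the normal cone is closed.
-/

namespace ChanceConstraint

/-! ### Clarke gradients and normal cones -/

section VariationalLemmas

variable {E : Type*} [NormedAddCommGroup E] [InnerProductSpace ℝ E]

/-- If `f` differs from the linear functional `⟪a, ·⟫` by a `ρ`-Lipschitz function near `x`, then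
every Clarke gradient of `f` at `x` is within `ρ` of `a`. -/
theorem norm_sub_le_of_mem_clarkeGradient {f : E → ℝ} {x a ζ : E} {ρ : ℝ} {U : Set E}
    (hρ0 : 0 ≤ ρ) (hU : U ∈ 𝓝 x)
    (hf : ∀ y ∈ U, ∀ z ∈ U, |f z - f y - inner ℝ a (z - y)| ≤ ρ * ‖z - y‖)
    (hζ : ζ ∈ clarkeGradient f x) : ‖ζ - a‖ ≤ ρ := by
  have hζv : ∀ v : E, inner ℝ ζ v ≤ inner ℝ a v + ρ * ‖v‖ := by
    intro v
    have hlim : clarkeDirDeriv f x v ≤ ((inner ℝ a v + ρ * ‖v‖ : ℝ) : EReal) := by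
      refine limsup_le_of_le ?_ ?_
      · isBoundedDefault
      have h1 : Tendsto (fun q : E × ℝ => q.1) (𝓝 x ×ˢ 𝓝[>] (0 : ℝ)) (𝓝 x) := tendsto_fst
      have h2 : Tendsto (fun q : E × ℝ => q.1 + q.2 • v) (𝓝 x ×ˢ 𝓝[>] (0 : ℝ)) (𝓝 x) := by
        have h3 : Tendsto (fun q : E × ℝ => q.2) (𝓝 x ×ˢ 𝓝[>] (0 : ℝ)) (𝓝 0) :=
          tendsto_nhds_of_tendsto_nhdsWithin tendsto_snd
        simpa using h1.add (h3.smul_const v)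
      have h4 : ∀ᶠ q : E × ℝ in 𝓝 x ×ˢ 𝓝[>] (0 : ℝ), q.2 ∈ Ioi (0 : ℝ) :=
        tendsto_snd.eventually self_mem_nhdsWithin
      filter_upwards [h1 hU, h2 hU, h4] with q hq1 hq2 hq3
      have hq3 : 0 < q.2 := hq3
      have := (abs_le.1 (hf _ hq1 _ hq2)).2
      rw [add_sub_cancel_left, inner_smul_right, norm_smul, Real.norm_of_nonneg hq3.le] at this
      rw [EReal.coe_le_coe_iff, div_le_iff₀ hq3]
      linarith
    exact EReal.coe_le_coe_iff.1 ((hζ v).trans hlim)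
  have h := hζv (ζ - a)
  have h2 : inner ℝ ζ (ζ - a) - inner ℝ a (ζ - a) = ‖ζ - a‖ * ‖ζ - a‖ := by
    rw [← inner_sub_left, real_inner_self_eq_norm_mul_norm]
  rcases (norm_nonneg (ζ - a)).eq_or_lt with h0 | h0
  · rwa [← h0]
  · exact le_of_mul_le_mul_right (by linarith) h0

/-- The graph of the normal cone of a closed set is closed. -/
theorem mem_normalCone_of_tendsto {C : Set E} (hC : IsClosed C) {x v : ℕ → E} {a w : E}
    (hx : Tendsto x atTop (𝓝 a)) (hv : Tendsto v atTop (𝓝 w))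
    (hmem : ∀ i, v i ∈ normalCone C (x i)) : w ∈ normalCone C a := by
  refine ⟨hC.mem_of_tendsto hx (Eventually.of_forall fun i => (hmem i).1), fun y hy => ?_⟩
  exact le_of_tendsto' (hv.inner (tendsto_const_nhds.sub hx)) fun i => (hmem i).2 y hy

end VariationalLemmas

/-! ### Expectations through the distribution function -/

theorem integrable_deriv_of_monotone_of_bounded {ψ : ℝ → ℝ} (hψ : ContDiff ℝ 1 ψ)
    (hmono : Monotone ψ) {M : ℝ} (hM : ∀ y, |ψ y| ≤ M) : Integrable (deriv ψ) := by
  have hc : Continuous (deriv ψ) := hψ.continuous_deriv le_rfl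
  refine integrable_of_intervalIntegral_norm_bounded (2 * M) (a := fun i : ℕ => -(i : ℝ))
    (b := fun i : ℕ => (i : ℝ)) (fun i => hc.integrableOn_Ioc)
    (tendsto_neg_atTop_atBot.comp tendsto_natCast_atTop_atTop) tendsto_natCast_atTop_atTop
    (Eventually.of_forall fun i => ?_)
  have h1 : ∀ η, ‖deriv ψ η‖ = deriv ψ η := fun η => Real.norm_of_nonneg hmono.deriv_nonneg
  simp only [h1]
  rw [intervalIntegral.integral_deriv_eq_sub
    (fun η _ => (hψ.differentiable one_ne_zero).differentiableAt) (hc.intervalIntegrable _ _)]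
  linarith [(abs_le.1 (hM i)).2, (abs_le.1 (hM (-i))).1]

theorem setIntegral_deriv_abs_lt {ψ : ℝ → ℝ} (hψ : ContDiff ℝ 1 ψ) {ε : ℝ} (hε : 0 < ε) :
    ∫ η in {η : ℝ | ε ≤ |η|}ᶜ, deriv ψ η = ψ ε - ψ (-ε) := by
  have hset : {η : ℝ | ε ≤ |η|}ᶜ = Ioo (-ε) ε := by
    ext η
    simp [abs_lt]
  rw [hset, ← integral_Ioc_eq_integral_Ioo, ← intervalIntegral.integral_of_le (by linarith),
    intervalIntegral.integral_deriv_eq_sub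
      (fun η _ => (hψ.differentiable one_ne_zero).differentiableAt)
      ((hψ.continuous_deriv le_rfl).intervalIntegrable _ _)]

section Expectation

variable {Ω : Type*} [MeasurableSpace Ω] (μ : Measure Ω) [IsProbabilityMeasure μ]

theorem measurable_measureReal_le (h : Ω → ℝ) : Measurable fun η : ℝ => μ.real {ω | h ω ≤ η} :=
  Monotone.measurable fun _ _ hab => measureReal_mono fun _ hω => le_trans hω hab

theorem integrable_deriv_mul_measureReal_le {ψ : ℝ → ℝ} (hint : Integrable (deriv ψ))
    (h : Ω → ℝ) : Integrable fun η => deriv ψ η * μ.real {ω | h ω ≤ η} := by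
  refine hint.mul_bdd (c := 1) (measurable_measureReal_le μ h).aestronglyMeasurable
    (Eventually.of_forall fun η => ?_)
  rw [Real.norm_of_nonneg measureReal_nonneg]
  exact measureReal_le_one

/-- Integration by parts for `E[ψ(h)]`, with the distribution function of `h` as integrator. -/
theorem integral_comp_eq_sub_integral_deriv_mul {ψ : ℝ → ℝ} (hψ : ContDiff ℝ 1 ψ)
    (hmono : Monotone ψ) (hint : Integrable (deriv ψ)) {l : ℝ} (hl : Tendsto ψ atTop (𝓝 l))
    {h : Ω → ℝ} (hh : Measurable h) :
    ∫ ω, ψ (h ω) ∂μ = l - ∫ η, deriv ψ η * μ.real {ω | h ω ≤ η} := by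
  have hset : MeasurableSet {q : Ω × ℝ | h q.1 ≤ q.2} :=
    measurableSet_le (hh.comp measurable_fst) measurable_snd
  have hprod : Integrable (Function.uncurry fun (ω : Ω) (η : ℝ) =>
      (Ici (h ω)).indicator (deriv ψ) η) (μ.prod volume) := by
    have h1 : Integrable (fun q : Ω × ℝ => deriv ψ q.2) (μ.prod volume) := hint.comp_snd μ
    refine (h1.indicator hset).congr (Eventually.of_forall fun q => ?_)
    simp [Function.uncurry, indicator]
  have hpt : ∀ ω, ψ (h ω) = l - ∫ η, (Ici (h ω)).indicator (deriv ψ) η := by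
    intro ω
    rw [integral_indicator measurableSet_Ici, integral_Ici_eq_integral_Ioi,
      integral_Ioi_of_hasDerivAt_of_nonneg'
        (fun η _ => (hψ.differentiable one_ne_zero η).hasDerivAt)
        (fun η _ => hmono.deriv_nonneg) hl]
    ring
  simp_rw [hpt]
  have hsub : ∫ ω, (l - ∫ η, (Ici (h ω)).indicator (deriv ψ) η) ∂μ
      = (∫ _, l ∂μ) - ∫ ω, (∫ η, (Ici (h ω)).indicator (deriv ψ) η) ∂μ :=
    integral_sub (integrable_const l) hprod.integral_prod_left
  rw [hsub, integral_integral_swap hprod]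
  simp only [integral_const, probReal_univ, one_smul]
  congr 2
  funext η
  have hη : (fun ω => (Ici (h ω)).indicator (deriv ψ) η)
      = {ω | h ω ≤ η}.indicator fun _ => deriv ψ η := by
    funext ω
    simp [indicator]
  have hmeas : MeasurableSet {ω | h ω ≤ η} := hh measurableSet_Iic
  rw [hη, integral_indicator hmeas, setIntegral_const, smul_eq_mul, mul_comm]

theorem integral_comp_sub_integral_comp {ψ : ℝ → ℝ} (hψ : ContDiff ℝ 1 ψ)
    (hmono : Monotone ψ) {M : ℝ} (hM : ∀ y, |ψ y| ≤ M) {h h' : Ω → ℝ} (hh : Measurable h)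
    (hh' : Measurable h') :
    ∫ ω, ψ (h' ω) ∂μ - ∫ ω, ψ (h ω) ∂μ
      = -∫ η, deriv ψ η * (μ.real {ω | h' ω ≤ η} - μ.real {ω | h ω ≤ η}) := by
  have hint := integrable_deriv_of_monotone_of_bounded hψ hmono hM
  have hl := tendsto_atTop_ciSup hmono ⟨M, by rintro _ ⟨y, rfl⟩; exact (abs_le.1 (hM y)).2⟩
  rw [integral_comp_eq_sub_integral_deriv_mul μ hψ hmono hint hl hh,
    integral_comp_eq_sub_integral_deriv_mul μ hψ hmono hint hl hh']
  simp_rw [mul_sub]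
  rw [integral_sub (integrable_deriv_mul_measureReal_le μ hint h')
    (integrable_deriv_mul_measureReal_le μ hint h)]
  ring

end Expectation

/-! ### Concentrating kernels -/

/-- Integrating against a nonnegative kernel `κ` a function `D` that is close to the constant `b`
off `S` and dominated by `r' * L` on `S`. -/
theorem abs_integral_mul_sub_le {κ D L : ℝ → ℝ} {S : Set ℝ} {b r r' : ℝ} (hS : MeasurableSet S)
    (hκ : ∀ η, 0 ≤ κ η) (hκint : Integrable κ) (hD : Integrable fun η => κ η * D η)
    (hL : Integrable fun η => L η * κ η) (hnear : ∀ η ∉ S, |D η - b| ≤ r)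
    (hfar : ∀ η ∈ S, |D η| ≤ L η * r') :
    |(∫ η, κ η * D η) - b * ∫ η in Sᶜ, κ η|
      ≤ r * (∫ η in Sᶜ, κ η) + r' * ∫ η in S, L η * κ η := by
  have hsplit : (∫ η, κ η * D η) - b * ∫ η in Sᶜ, κ η
      = (∫ η in Sᶜ, κ η * (D η - b)) + ∫ η in S, κ η * D η := by
    rw [← integral_add_compl hS hD]
    have : ∫ η in Sᶜ, κ η * (D η - b) = (∫ η in Sᶜ, κ η * D η) - b * ∫ η in Sᶜ, κ η := by
      rw [← integral_const_mul, ← integral_sub hD.integrableOn (hκint.const_mul b).integrableOn]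
      exact integral_congr_ae (Eventually.of_forall fun η => by ring)
    rw [this]
    ring
  rw [hsplit]
  refine (abs_add_le _ _).trans (add_le_add ?_ ?_)
  · rw [← integral_const_mul, ← Real.norm_eq_abs]
    refine norm_integral_le_of_norm_le (hκint.const_mul r).integrableOn
      (ae_restrict_of_forall_mem hS.compl fun η hη => ?_)
    rw [norm_mul, Real.norm_of_nonneg (hκ η), Real.norm_eq_abs, mul_comm]
    exact mul_le_mul_of_nonneg_right (hnear η hη) (hκ η)
  · rw [← integral_const_mul, ← Real.norm_eq_abs]
    refine norm_integral_le_of_norm_le (hL.const_mul r').integrableOn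
      (ae_restrict_of_forall_mem hS fun η hη => ?_)
    rw [norm_mul, Real.norm_of_nonneg (hκ η), Real.norm_eq_abs]
    calc κ η * |D η| ≤ κ η * (L η * r') := mul_le_mul_of_nonneg_left (hfar η hη) (hκ η)
      _ = r' * (L η * κ η) := by ring

/-- If `F` is strictly differentiable at `(x₀, 0)` and the kernels `κ k` concentrate at zero, the
averages of `F x` against `κ k` are strictly differentiable at `x₀` up to an error `ρ`, uniformly
for large `k`. -/
theorem eventually_abs_integral_sub_le {E : Type*} [NormedAddCommGroup E] [NormedSpace ℝ E]
    {F : E → ℝ → ℝ} {F' : E × ℝ →L[ℝ] ℝ} {x₀ : E}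
    (hF : HasStrictFDerivAt (fun q : E × ℝ => F q.1 q.2) F' (x₀, 0))
    {X' : Set E} (hX' : X' ∈ 𝓝 x₀) {L : ℝ → ℝ}
    (hFL : ∀ η, ∀ x ∈ X', ∀ y ∈ X', |F x η - F y η| ≤ L η * ‖x - y‖)
    {κ : ℕ → ℝ → ℝ} (hκ : ∀ k η, 0 ≤ κ k η) (hκint : ∀ k, Integrable (κ k))
    (hκF : ∀ k x, Integrable fun η => κ k η * F x η)
    (hκL : ∀ k, Integrable fun η => L η * κ k η)
    {ε : ℕ → ℝ} (hε : Tendsto ε atTop (𝓝 0))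
    (hfar : Tendsto (fun k => ∫ η in {η : ℝ | ε k ≤ |η|}, L η * κ k η) atTop (𝓝 0))
    (hnear : Tendsto (fun k => ∫ η in {η : ℝ | ε k ≤ |η|}ᶜ, κ k η) atTop (𝓝 1))
    {ρ : ℝ} (hρ : 0 < ρ) :
    ∃ U ∈ 𝓝 x₀, ∀ᶠ k in atTop, ∀ x ∈ U, ∀ y ∈ U,
      |(∫ η, κ k η * (F y η - F x η)) - F' (y - x, 0)| ≤ ρ * ‖y - x‖ := by
  obtain ⟨V, hV, hVF⟩ : ∃ V ∈ 𝓝 (x₀, (0 : ℝ)), ∀ q ∈ V, ∀ q' ∈ V,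
      ‖F q.1 q.2 - F q'.1 q'.2 - F' (q - q')‖ ≤ ρ / 2 * ‖q - q'‖ := by
    have h1 := hF.isLittleO.def (half_pos hρ)
    rw [nhds_prod_eq] at h1
    obtain ⟨V, hV, h2⟩ := mem_prod_self_iff.1 h1
    exact ⟨V, hV, fun q hq q' hq' => h2 (mk_mem_prod hq hq')⟩
  obtain ⟨W, hW, T, hT, hWT⟩ := mem_nhds_prod_iff.1 hV
  obtain ⟨δ, hδ, hδT⟩ := Metric.mem_nhds_iff.1 hT
  refine ⟨W ∩ X', inter_mem hW hX', ?_⟩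
  have hlim : Tendsto (fun k => ρ / 2 * (∫ η in {η : ℝ | ε k ≤ |η|}ᶜ, κ k η)
      + (∫ η in {η : ℝ | ε k ≤ |η|}, L η * κ k η)
      + ‖F'‖ * |(∫ η in {η : ℝ | ε k ≤ |η|}ᶜ, κ k η) - 1|) atTop (𝓝 (ρ / 2)) := by
    simpa using ((hnear.const_mul (ρ / 2)).add hfar).add
      (((hnear.sub_const 1).abs).const_mul ‖F'‖)
  -- the bracket is the Lipschitz constant that the final estimate produces
  filter_upwards [hlim.eventually_lt_const (half_lt_self hρ), hε.eventually_lt_const hδ]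
    with k hk hεk x hx y hy
  have hS : MeasurableSet {η : ℝ | ε k ≤ |η|} := measurableSet_le measurable_const measurable_norm
  have hmain := abs_integral_mul_sub_le (κ := κ k) (D := fun η => F y η - F x η) (L := L)
    (b := F' (y - x, 0)) (r := ρ / 2 * ‖y - x‖) (r' := ‖y - x‖) hS (hκ k) (hκint k)
    (((hκF k y).sub (hκF k x)).congr (Eventually.of_forall fun η => (mul_sub _ _ _).symm)) (hκL k)
    (fun η hη => by
      have hηT : η ∈ T := hδT (by
        rw [mem_ball_zero_iff, Real.norm_eq_abs]
        exact (not_le.1 hη).trans hεk)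
      have := hVF (y, η) (hWT ⟨hy.1, hηT⟩) (x, η) (hWT ⟨hx.1, hηT⟩)
      simpa [Prod.norm_def] using this)
    (fun η _ => hFL η y hy.2 x hx.2)
  have hF'le : |F' (y - x, 0)| ≤ ‖F'‖ * ‖y - x‖ := by
    simpa [Prod.norm_def] using F'.le_opNorm (y - x, 0)
  set c := ∫ η in {η : ℝ | ε k ≤ |η|}ᶜ, κ k η
  set t := ∫ η in {η : ℝ | ε k ≤ |η|}, L η * κ k η
  calc |(∫ η, κ k η * (F y η - F x η)) - F' (y - x, 0)|
      = |((∫ η, κ k η * (F y η - F x η)) - F' (y - x, 0) * c) + F' (y - x, 0) * (c - 1)| := by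
        congr 1
        ring
    _ ≤ (ρ / 2 * ‖y - x‖ * c + ‖y - x‖ * t) + ‖F'‖ * ‖y - x‖ * |c - 1| := by
        refine (abs_add_le _ _).trans (add_le_add hmain ?_)
        rw [abs_mul]
        exact mul_le_mul_of_nonneg_right hF'le (abs_nonneg _)
    _ = (ρ / 2 * c + t + ‖F'‖ * |c - 1|) * ‖y - x‖ := by ring
    _ ≤ ρ * ‖y - x‖ := mul_le_mul_of_nonneg_right hk.le (norm_nonneg _)

/-! ### The smoothed objective and the violation probability -/

variable {n d m : ℕ}

theorem SmoothingScaling.eq_pow_mul {φ : ℝ → ℝ → ℝ} {τ : ℕ → Fin m → ℝ} {τc : ℝ}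
    (hscale : SmoothingScaling φ τ τc) (k : ℕ) (j : Fin m) : τ k j = τ 0 j * τc ^ k := by
  induction k with
  | zero => simp
  | succ k ih => rw [hscale.step, ih, pow_succ]; ring

theorem SmoothingScaling.apply_mul_pow {φ : ℝ → ℝ → ℝ} {τ : ℕ → Fin m → ℝ} {τc : ℝ}
    (hscale : SmoothingScaling φ τ τc) (k : ℕ) (j : Fin m) (y : ℝ) :
    φ (τ 0 j * y) (τ k j) = φ y (τc ^ k) := by
  rw [hscale.eq_pow_mul k j]
  exact hscale.homogeneous _ (hscale.init_pos j) _ _ (pow_pos hscale.ratio_mem.1 k)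

theorem measurable_iSup_div {g : Fin m → EuclideanSpace ℝ (Fin n) → EuclideanSpace ℝ (Fin d) → ℝ}
    (hg : ∀ j, ContDiff ℝ 1
      (fun q : EuclideanSpace ℝ (Fin n) × EuclideanSpace ℝ (Fin d) => g j q.1 q.2))
    (s : Fin m → ℝ) (x : EuclideanSpace ℝ (Fin n)) :
    Measurable fun ξ => ⨆ j, g j x ξ / s j := by
  refine Measurable.iSup fun j => Measurable.div_const ?_ _
  exact ((hg j).continuous.comp (Continuous.prodMk_right x)).measurable

theorem smoothedProb_eq_integral (hm : 0 < m) (P : Measure (EuclideanSpace ℝ (Fin d)))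
    (g : Fin m → EuclideanSpace ℝ (Fin n) → EuclideanSpace ℝ (Fin d) → ℝ)
    {φ : ℝ → ℝ → ℝ} {τ : ℕ → Fin m → ℝ} {τc : ℝ} (hscale : SmoothingScaling φ τ τc) {k : ℕ}
    (hcont : Continuous fun y => φ y (τc ^ k)) (hmono : Monotone fun y => φ y (τc ^ k))
    (x : EuclideanSpace ℝ (Fin n)) :
    smoothedProb P g (fun j y => φ y (τ k j)) x
      = ∫ ξ, φ (⨆ j, g j x ξ / τ 0 j) (τc ^ k) ∂P := by
  have : Nonempty (Fin m) := ⟨⟨0, hm⟩⟩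
  unfold smoothedProb
  congr 1
  funext ξ
  refine Eq.trans ?_ (Monotone.map_ciSup_of_continuousAt (f := fun y => φ y (τc ^ k))
    hcont.continuousAt hmono (Set.finite_range _).bddAbove).symm
  refine iSup_congr fun j => ?_
  rw [← hscale.apply_mul_pow k j, mul_div_cancel₀ _ (hscale.init_pos j).ne']

theorem violationProb_eq_one_sub_scaledCdf (hm : 0 < m)
    (P : Measure (EuclideanSpace ℝ (Fin d))) [IsProbabilityMeasure P]
    {g : Fin m → EuclideanSpace ℝ (Fin n) → EuclideanSpace ℝ (Fin d) → ℝ}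
    (hg : ∀ j, ContDiff ℝ 1
      (fun q : EuclideanSpace ℝ (Fin n) × EuclideanSpace ℝ (Fin d) => g j q.1 q.2))
    {s : Fin m → ℝ} (hs : ∀ j, 0 < s j) :
    violationProb P g = fun x => 1 - scaledCdf P g s x 0 := by
  have : Nonempty (Fin m) := ⟨⟨0, hm⟩⟩
  funext x
  have hset : {ξ | ¬ ∀ j, g j x ξ ≤ 0} = {ξ | (⨆ j, g j x ξ / s j) ≤ 0}ᶜ := by
    ext ξ
    rw [mem_ofPred_eq, mem_compl_iff, mem_ofPred_eq, ciSup_le_iff (Set.finite_range _).bddAbove]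
    simp [div_le_iff₀ (hs _)]
  unfold violationProb scaledCdf
  have hmeas : MeasurableSet {ξ | (⨆ j, g j x ξ / s j) ≤ 0} :=
    measurable_iSup_div hg s x measurableSet_Iic
  rw [hset, probReal_compl_eq_one_sub hmeas]

theorem hasFDerivAt_violationProb (hm : 0 < m)
    (P : Measure (EuclideanSpace ℝ (Fin d))) [IsProbabilityMeasure P]
    {g : Fin m → EuclideanSpace ℝ (Fin n) → EuclideanSpace ℝ (Fin d) → ℝ}
    (hg : ∀ j, ContDiff ℝ 1
      (fun q : EuclideanSpace ℝ (Fin n) × EuclideanSpace ℝ (Fin d) => g j q.1 q.2))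
    {s : Fin m → ℝ} (hs : ∀ j, 0 < s j) {x : EuclideanSpace ℝ (Fin n)}
    {F' : EuclideanSpace ℝ (Fin n) × ℝ →L[ℝ] ℝ}
    (hF : HasFDerivAt (fun q : EuclideanSpace ℝ (Fin n) × ℝ => scaledCdf P g s q.1 q.2) F' (x, 0)) :
    HasFDerivAt (violationProb P g)
      (-F'.comp (ContinuousLinearMap.inl ℝ (EuclideanSpace ℝ (Fin n)) ℝ)) x := by
  rw [violationProb_eq_one_sub_scaledCdf hm P hg hs]
  exact (HasFDerivAt.comp (f := fun y => (y, (0 : ℝ))) x hF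
    (hasFDerivAt_prodMk_left x (0 : ℝ))).const_sub 1

/-- The normalized functions `φ(·; τc ^ k)` inherit the regularity of the smoothing functions, which
are rescalings of them. -/
theorem SmoothingScaling.regular_pow (hm : 0 < m) {φ : ℝ → ℝ → ℝ} {τ : ℕ → Fin m → ℝ} {τc : ℝ}
    (hscale : SmoothingScaling φ τ τc) (hbasic : SmoothingBasic fun k j y => φ y (τ k j))
    (hadv : SmoothingAdvanced fun k j y => φ y (τ k j)) (k : ℕ) :
    ContDiff ℝ 1 (fun y => φ y (τc ^ k)) ∧ Monotone (fun y => φ y (τc ^ k)) ∧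
      (∃ M, ∀ y, |φ y (τc ^ k)| ≤ M) ∧ ∃ M, ∀ y, |deriv (fun y => φ y (τc ^ k)) y| ≤ M := by
  let j : Fin m := ⟨0, hm⟩
  have heq : (fun y => φ y (τc ^ k)) = fun y => φ (τ 0 j * y) (τ k j) :=
    funext fun y => (hscale.apply_mul_pow k j y).symm
  have hpos := hscale.init_pos j
  refine ⟨?_, ?_, ?_, ?_⟩
  · rw [heq]
    exact (hbasic.contDiff k j).comp (contDiff_const.mul contDiff_id)
  · rw [heq]
    exact (hbasic.monotone k j).comp fun a b hab => mul_le_mul_of_nonneg_left hab hpos.le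
  · obtain ⟨M, -, hM⟩ := hbasic.equibounded
    exact ⟨M, fun y => by rw [← hscale.apply_mul_pow k j]; exact hM k j _⟩
  · obtain ⟨M, hM⟩ := hadv.deriv_bounded k j
    refine ⟨τ 0 j * M, fun y => ?_⟩
    rw [heq, deriv_comp_mul_left (τ 0 j) (fun y => φ y (τ k j)), smul_eq_mul, abs_mul,
      abs_of_pos hpos]
    exact mul_le_mul_of_nonneg_left (hM _) hpos.le

/-- The increments of the smoothed objective as an average of those of the distribution function. -/
theorem smoothedProb_sub_smoothedProb (hm : 0 < m) (P : Measure (EuclideanSpace ℝ (Fin d)))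
    [IsProbabilityMeasure P]
    {g : Fin m → EuclideanSpace ℝ (Fin n) → EuclideanSpace ℝ (Fin d) → ℝ}
    (hg : ∀ j, ContDiff ℝ 1
      (fun q : EuclideanSpace ℝ (Fin n) × EuclideanSpace ℝ (Fin d) => g j q.1 q.2))
    {φ : ℝ → ℝ → ℝ} {τ : ℕ → Fin m → ℝ} {τc : ℝ}
    (hscale : SmoothingScaling φ τ τc) (hbasic : SmoothingBasic fun k j y => φ y (τ k j))
    (hadv : SmoothingAdvanced fun k j y => φ y (τ k j)) (k : ℕ)
    (x y : EuclideanSpace ℝ (Fin n)) :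
    smoothedProb P g (fun j y => φ y (τ k j)) y - smoothedProb P g (fun j y => φ y (τ k j)) x
      = -∫ η, deriv (fun y => φ y (τc ^ k)) η
          * (scaledCdf P g (τ 0) y η - scaledCdf P g (τ 0) x η) := by
  obtain ⟨hC, hmono, ⟨M, hM⟩, -⟩ := hscale.regular_pow hm hbasic hadv k
  rw [smoothedProb_eq_integral hm P g hscale hC.continuous hmono,
    smoothedProb_eq_integral hm P g hscale hC.continuous hmono]
  exact integral_comp_sub_integral_comp P hC hmono hM (measurable_iSup_div hg (τ 0) x)
    (measurable_iSup_div hg (τ 0) y)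

theorem lipschitzOnWith_smoothedProb (hm : 0 < m) (P : Measure (EuclideanSpace ℝ (Fin d)))
    [IsProbabilityMeasure P]
    {g : Fin m → EuclideanSpace ℝ (Fin n) → EuclideanSpace ℝ (Fin d) → ℝ}
    (hg : ∀ j, ContDiff ℝ 1
      (fun q : EuclideanSpace ℝ (Fin n) × EuclideanSpace ℝ (Fin d) => g j q.1 q.2))
    {φ : ℝ → ℝ → ℝ} {τ : ℕ → Fin m → ℝ} {τc : ℝ}
    (hscale : SmoothingScaling φ τ τc) (hbasic : SmoothingBasic fun k j y => φ y (τ k j))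
    (hadv : SmoothingAdvanced fun k j y => φ y (τ k j)) (k : ℕ)
    {X' : Set (EuclideanSpace ℝ (Fin n))} {L : ℝ → ℝ}
    (hL : Integrable fun η => L η * deriv (fun y => φ y (τc ^ k)) η)
    (hFL : ∀ η, ∀ x ∈ X', ∀ y ∈ X',
      |scaledCdf P g (τ 0) x η - scaledCdf P g (τ 0) y η| ≤ L η * ‖x - y‖) :
    LipschitzOnWith (∫ η, L η * deriv (fun y => φ y (τc ^ k)) η).toNNReal
      (smoothedProb P g fun j y => φ y (τ k j)) X' := by
  have hmono := (hscale.regular_pow hm hbasic hadv k).2.1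
  refine LipschitzOnWith.of_dist_le_mul fun x hx y hy => ?_
  rw [Real.dist_eq, dist_eq_norm, smoothedProb_sub_smoothedProb hm P hg hscale hbasic hadv k y x,
    abs_neg]
  refine le_trans ?_ (mul_le_mul_of_nonneg_right (Real.le_coe_toNNReal _) (norm_nonneg _))
  rw [← integral_mul_const, ← Real.norm_eq_abs]
  refine norm_integral_le_of_norm_le (hL.mul_const _) (Eventually.of_forall fun η => ?_)
  rw [norm_mul, Real.norm_of_nonneg hmono.deriv_nonneg, Real.norm_eq_abs]
  calc deriv (fun y => φ y (τc ^ k)) η * |scaledCdf P g (τ 0) x η - scaledCdf P g (τ 0) y η|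
      ≤ deriv (fun y => φ y (τc ^ k)) η * (L η * ‖x - y‖) :=
        mul_le_mul_of_nonneg_left (hFL η x hx y hy) hmono.deriv_nonneg
    _ = L η * deriv (fun y => φ y (τc ^ k)) η * ‖x - y‖ := by ring

/-- The smoothed objectives are, uniformly for large `k`, strictly differentiable at feasible points
up to an error `ρ`, with the gradient of the violation probability as derivative. -/
theorem eventually_abs_sub_sub_inner_le (hm : 0 < m) (P : Measure (EuclideanSpace ℝ (Fin d)))
    [IsProbabilityMeasure P]
    {g : Fin m → EuclideanSpace ℝ (Fin n) → EuclideanSpace ℝ (Fin d) → ℝ}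
    (hg : ∀ j, ContDiff ℝ 1
      (fun q : EuclideanSpace ℝ (Fin n) × EuclideanSpace ℝ (Fin d) => g j q.1 q.2))
    {φ : ℝ → ℝ → ℝ} {τ : ℕ → Fin m → ℝ} {τc : ℝ}
    (hscale : SmoothingScaling φ τ τc) (hbasic : SmoothingBasic fun k j y => φ y (τ k j))
    (hadv : SmoothingAdvanced fun k j y => φ y (τ k j))
    {X' : Set (EuclideanSpace ℝ (Fin n))} {x₀ : EuclideanSpace ℝ (Fin n)} (hX' : X' ∈ 𝓝 x₀)
    {F' : EuclideanSpace ℝ (Fin n) × ℝ →L[ℝ] ℝ}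
    (hF : HasStrictFDerivAt
      (fun q : EuclideanSpace ℝ (Fin n) × ℝ => scaledCdf P g (τ 0) q.1 q.2) F' (x₀, 0))
    {L : ℝ → ℝ} (hL : ∀ k, Integrable fun η => L η * deriv (fun y => φ y (τc ^ k)) η)
    (hFL : ∀ η, ∀ x ∈ X', ∀ y ∈ X',
      |scaledCdf P g (τ 0) x η - scaledCdf P g (τ 0) y η| ≤ L η * ‖x - y‖)
    {ε : ℕ → ℝ} (hεpos : ∀ k, 0 < ε k) (hε : Tendsto ε atTop (𝓝 0))
    (hfar : Tendsto
      (fun k => ∫ η in {η : ℝ | ε k ≤ |η|}, L η * deriv (fun y => φ y (τc ^ k)) η) atTop (𝓝 0))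
    (hnear : Tendsto (fun k => φ (ε k) (τc ^ k) - φ (-ε k) (τc ^ k)) atTop (𝓝 1))
    {ρ : ℝ} (hρ : 0 < ρ) :
    ∃ U ∈ 𝓝 x₀, ∀ᶠ k in atTop, ∀ x ∈ U, ∀ y ∈ U,
      |smoothedProb P g (fun j y => φ y (τ k j)) y - smoothedProb P g (fun j y => φ y (τ k j)) x
        - inner ℝ (gradient (violationProb P g) x₀) (y - x)| ≤ ρ * ‖y - x‖ := by
  have hreg := hscale.regular_pow hm hbasic hadv
  have hint : ∀ k, Integrable (deriv fun y => φ y (τc ^ k)) := fun k => by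
    obtain ⟨hC, hmono, ⟨M, hM⟩, -⟩ := hreg k
    exact integrable_deriv_of_monotone_of_bounded hC hmono hM
  obtain ⟨U, hU, hUk⟩ := eventually_abs_integral_sub_le hF hX' hFL
    (κ := fun k => deriv fun y => φ y (τc ^ k)) (fun k η => (hreg k).2.1.deriv_nonneg) hint
    (fun k x => integrable_deriv_mul_measureReal_le P (hint k) _) hL hε hfar
    (hnear.congr fun k => (setIntegral_deriv_abs_lt (hreg k).1 (hεpos k)).symm) hρ
  have hgrad : ∀ v, inner ℝ (gradient (violationProb P g) x₀) v = -F' (v, 0) := by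
    intro v
    rw [inner_gradient_left,
      (hasFDerivAt_violationProb hm P hg hscale.init_pos hF.hasFDerivAt).fderiv]
    simp
  refine ⟨U, hU, hUk.mono fun k hk x hx y hy => ?_⟩
  rw [smoothedProb_sub_smoothedProb hm P hg hscale hbasic hadv k, hgrad, ← abs_neg]
  convert hk x hx y hy using 2
  ring

end ChanceConstraint

/-! ### Consistency of the Clarke gradients -/

theorem mainTheorem3 {n d m : ℕ} (hm : 0 < m)
    (X : Set (EuclideanSpace ℝ (Fin n))) (hXne : X.Nonempty) (hXclosed : IsClosed X)
    (hXconvex : Convex ℝ X)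
    (f : EuclideanSpace ℝ (Fin n) → ℝ) (hf : Continuous f) (hfq : QuasiconvexOn ℝ univ f)
    (P : Measure (EuclideanSpace ℝ (Fin d))) [IsProbabilityMeasure P]
    (Ξ : Set (EuclideanSpace ℝ (Fin d))) (hΞ : ∀ᵐ ξ ∂P, ξ ∈ Ξ)
    (g : Fin m → EuclideanSpace ℝ (Fin n) → EuclideanSpace ℝ (Fin d) → ℝ)
    (hg : ∀ j, ContDiff ℝ 1
      (fun q : EuclideanSpace ℝ (Fin n) × EuclideanSpace ℝ (Fin d) => g j q.1 q.2))
    (ν : ℝ)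
    -- the smoothing functions are `φ (·; τ k j)`; `k = 0` is the first index
    (φ : ℝ → ℝ → ℝ) (τ : ℕ → Fin m → ℝ) (τc : ℝ)
    (hreg : ChanceConstraint.ConstraintRegularity P Ξ (ChanceConstraint.levelSet X f ν) g)
    (hbasic : ChanceConstraint.SmoothingBasic (fun k j y => φ y (τ k j)))
    (hadv : ChanceConstraint.SmoothingAdvanced (fun k j y => φ y (τ k j)))
    (hscale : ChanceConstraint.SmoothingScaling φ τ τc)
    (hcdf : ChanceConstraint.CdfCondition (ChanceConstraint.levelSet X f ν)
      (ChanceConstraint.scaledCdf P g (τ 0)) φ τc) :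
    (∀ k, ∀ x ∈ ChanceConstraint.levelSet X f ν,
      ChanceConstraint.LipschitzNear
        (ChanceConstraint.smoothedProb P g (fun j y => φ y (τ k j))) x) ∧
    (∀ x ∈ ChanceConstraint.levelSet X f ν,
      DifferentiableAt ℝ (ChanceConstraint.violationProb P g) x) ∧
    ∀ x₀ : EuclideanSpace ℝ (Fin n),
      ChanceConstraint.outerLimit
        (fun k x =>
          ChanceConstraint.clarkeGradient
            (ChanceConstraint.smoothedProb P g (fun j y => φ y (τ k j))) x +
          ChanceConstraint.normalCone (ChanceConstraint.levelSet X f ν) x) x₀ ⊆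
      {gradient (ChanceConstraint.violationProb P g) x₀} +
        ChanceConstraint.normalCone (ChanceConstraint.levelSet X f ν) x₀ := by
  obtain ⟨X', θ, LF, ε, hX'o, hCX', hθ, hFC, -, -, hLFint, hFL, hεpos, -, hε, hfar, hnear⟩ :=
    hcdf
  have hLk : ∀ k, Integrable fun η => LF η * deriv (fun y => φ y (τc ^ k)) η := by
    intro k
    obtain ⟨hC, -, -, M, hM⟩ := hscale.regular_pow hm hbasic hadv k
    exact hLFint.mul_bdd (c := M) (hC.continuous_deriv le_rfl).aestronglyMeasurable
      (Eventually.of_forall hM)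
  have hstrict : ∀ x ∈ ChanceConstraint.levelSet X f ν,
      ∃ F' : EuclideanSpace ℝ (Fin n) × ℝ →L[ℝ] ℝ, HasStrictFDerivAt
      (fun q : EuclideanSpace ℝ (Fin n) × ℝ => ChanceConstraint.scaledCdf P g (τ 0) q.1 q.2)
      F' (x, 0) := by
    intro x hx
    have hnhds : X' ×ˢ Ioo (-θ) θ ∈ 𝓝 (x, (0 : ℝ)) :=
      prod_mem_nhds (hX'o.mem_nhds (hCX' hx)) (Ioo_mem_nhds (neg_lt_zero.2 hθ) hθ)
    exact ⟨_, (hFC.contDiffAt hnhds).hasStrictFDerivAt one_ne_zero⟩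
  refine ⟨fun k x hx => ?_, fun x hx => ?_, fun x₀ => ?_⟩
  · exact ⟨_, X', hX'o.mem_nhds (hCX' hx),
      ChanceConstraint.lipschitzOnWith_smoothedProb hm P hg hscale hbasic hadv k (hLk k) hFL⟩
  · obtain ⟨F', hF'⟩ := hstrict x hx
    exact (ChanceConstraint.hasFDerivAt_violationProb hm P hg hscale.init_pos
      hF'.hasFDerivAt).differentiableAt
  · rintro v ⟨κ, x, w, hκ, hx, hw, hwv⟩
    choose ζ hζ u hu hζu using fun i => Set.mem_add.1 (hw i)
    have hclosed : IsClosed (ChanceConstraint.levelSet X f ν) :=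
      hXclosed.inter (isClosed_le hf continuous_const)
    have hx₀ : x₀ ∈ ChanceConstraint.levelSet X f ν :=
      hclosed.mem_of_tendsto hx (Eventually.of_forall fun i => (hu i).1)
    obtain ⟨F', hF'⟩ := hstrict x₀ hx₀
    have hζlim : Tendsto ζ atTop (𝓝 (gradient (ChanceConstraint.violationProb P g) x₀)) := by
      refine Metric.tendsto_nhds.2 fun ρ hρ => ?_
      obtain ⟨U, hU, hUk⟩ := ChanceConstraint.eventually_abs_sub_sub_inner_le hm P hg hscale
        hbasic hadv (hX'o.mem_nhds (hCX' hx₀)) hF' hLk hFL hεpos hε hfar hnear (half_pos hρ)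
      filter_upwards [hx.eventually (eventually_mem_nhds_iff.2 hU), hκ.eventually hUk] with i hi hki
      rw [dist_eq_norm]
      exact (ChanceConstraint.norm_sub_le_of_mem_clarkeGradient (half_pos hρ).le hi hki
        (hζ i)).trans_lt (half_lt_self hρ)
    have hulim : Tendsto u atTop (𝓝 (v - gradient (ChanceConstraint.violationProb P g) x₀)) :=
      (hwv.sub hζlim).congr fun i => by rw [← hζu i, add_sub_cancel_left]
    exact Set.mem_add.2 ⟨_, rfl, _,
      ChanceConstraint.mem_normalCone_of_tendsto hclosed hx hulim hu, add_sub_cancel _ _⟩
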